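/- Let $(M,\omega)$ be a nonempty closed (compact, without boundary) symplectic manifold of dimension $2n$ with $n\geq 1$, and let the torus $T=U(1)^r$ act on $(M,\omega)$ in a Hamiltonian fashion; that is, the action is smooth, preserves $\omega$, and admits a moment map $\mu:M\to\mathfrak t^*$, i.e. a smooth map with $d\langle\mu,X\rangle=\omega(X_M,\cdot\,)$ for all $X\in\mathfrak t$, where $X_M(p)=\frac{d}{d\epsilon}\big|_{\epsilon=0}\,e^{-\epsilon X}\cdot p$. Assume that the set $M^T$ of fixed points is discrete. For $p\in M^T$ let $\alpha_{pj}\in\mathbb Z^r$, $j=1,\dots,n$, be the weights of the isotropy representation of $T$ on $T_pM$, where $T_pM$ is regarded as a complex vector space by means of a $T$-invariant complex structure compatible with $\omega$ (the weights do not depend on its choice). Then no open half-space of $\mathbb R^r$ bounded by a hyperplane through the origin contains all the weights $\alpha_{pj}$, $p\in M^T$, $j=1,\dots,n$; that is, there is no nonzero $u\in\mathbb R^r$ such that $\langle u,\alpha_{pj}\rangle>0$ for all $p\in M^T$ and all $j$. -/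

import Mathlib

open scoped Manifold ContDiff

noncomputable section

/-- The torus `T = U(1)^r`. -/
abbrev Torus (r : ℕ) : Type := Fin r → Circle

/-- The model with corners of the torus as a product of circles. -/
abbrev torusModel (r : ℕ) := ModelWithCorners.pi fun _ : Fin r => 𝓡 1

/-- The exponential map `(u₁, …, u_r) ↦ (e^{i u₁}, …, e^{i u_r})`, the Lie algebra
`𝔱 = iℝ ⊕ ⋯ ⊕ iℝ` of the torus being identified with `ℝ^r`. -/
def torusExp {r : ℕ} (u : EuclideanSpace ℝ (Fin r)) : Torus r := fun k => Circle.exp (u k)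

/-- The character `t ↦ t^a = t₁^{a₁} ⋯ t_r^{a_r}` of the torus attached to `a ∈ ℤ^r`. -/
def torusChar {r : ℕ} (a : Fin r → ℤ) (t : Torus r) : Circle := ∏ k, t k ^ a k

/-- The inclusion `ℤ^r ⊆ ℝ^r`. -/
def latticeVec {r : ℕ} (a : Fin r → ℤ) : EuclideanSpace ℝ (Fin r) :=
  WithLp.toLp 2 fun k => (a k : ℝ)

/-- The open half-space of `ℝ^r` with inner normal `u`, bounded by the linear hyperplane `u^⊥`
(a half-space when `u ≠ 0`). -/
def openHalfSpace {r : ℕ} (u : EuclideanSpace ℝ (Fin r)) : Set (EuclideanSpace ℝ (Fin r)) :=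
  {x | 0 < inner ℝ u x}

section Symplectic

variable {m : ℕ} {M : Type*} [TopologicalSpace M] [ChartedSpace (EuclideanSpace ℝ (Fin m)) M]

variable (m M) in
/-- A field of alternating bilinear forms on the tangent spaces of the `m`-manifold `M`
(no regularity in the base point is imposed here). -/
abbrev TwoForm := (x : M) → (TangentSpace (𝓡 m) x) [⋀^Fin 2]→L[ℝ] ℝ

/-- The expression of a 2-form in the chart at `x₀`, i.e. its pull-back by the inverse of the
chart, a differential form on the (open) target of the chart. -/
def TwoForm.inChart (Ω : TwoForm m M) (x₀ : M) (y : EuclideanSpace ℝ (Fin m)) :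
    (EuclideanSpace ℝ (Fin m)) [⋀^Fin 2]→L[ℝ] ℝ :=
  (Ω ((extChartAt (𝓡 m) x₀).symm y)).compContinuousLinearMap
    (mfderiv 𝓘(ℝ, EuclideanSpace ℝ (Fin m)) (𝓡 m) (extChartAt (𝓡 m) x₀).symm y)

/-- `Ω` is a symplectic form: a smooth, closed and nondegenerate 2-form. -/
structure IsSymplecticForm (Ω : TwoForm m M) : Prop where
  smooth : ∀ x₀ : M, ContDiffOn ℝ ∞ (Ω.inChart x₀) (extChartAt (𝓡 m) x₀).target
  closed : ∀ x₀ : M, ∀ y ∈ (extChartAt (𝓡 m) x₀).target, extDeriv (Ω.inChart x₀) y = 0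
  nondegenerate : ∀ (x : M) (v : TangentSpace (𝓡 m) x),
    (∀ w : TangentSpace (𝓡 m) x, Ω x ![v, w] = 0) → v = 0

variable {r : ℕ} [MulAction (Torus r) M]

/-- The differential at `x` of the diffeomorphism of `M` given by `t`. -/
def actionDeriv (m : ℕ) {M : Type*} [TopologicalSpace M]
    [ChartedSpace (EuclideanSpace ℝ (Fin m)) M] {r : ℕ} [MulAction (Torus r) M]
    (t : Torus r) (x : M) : TangentSpace (𝓡 m) x →L[ℝ] TangentSpace (𝓡 m) (t • x) :=
  mfderiv (𝓡 m) (𝓡 m) (fun y : M => t • y) x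

/-- The vector field `X_M(x) = d/dε (e^{-εX} · x)` at `ε = 0`, where `X ∈ 𝔱` corresponds to
`u ∈ ℝ^r`. (The curve is at `x` for `ε = 0`, so its velocity is a tangent vector at `x`.) -/
def fundamentalField (m : ℕ) {M : Type*} [TopologicalSpace M]
    [ChartedSpace (EuclideanSpace ℝ (Fin m)) M] {r : ℕ} [MulAction (Torus r) M]
    (u : EuclideanSpace ℝ (Fin r)) (x : M) : TangentSpace (𝓡 m) x :=
  mfderiv 𝓘(ℝ, ℝ) (𝓡 m) (fun ε : ℝ => torusExp (-(ε • u)) • x) 0 (1 : ℝ)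

/-- `μ` is a moment map: a smooth map with `d⟨μ, X⟩ = Ω(X_M, ·)` for all `X ∈ 𝔱`, where
`𝔱* = (ℝ^r)*` is identified with `ℝ^r` by the standard inner product. -/
structure IsMomentMap (Ω : TwoForm m M) (μ : M → EuclideanSpace ℝ (Fin r)) : Prop where
  smooth : ContMDiff (𝓡 m) 𝓘(ℝ, EuclideanSpace ℝ (Fin r)) ∞ μ
  deriv_eq : ∀ (u : EuclideanSpace ℝ (Fin r)) (x : M) (v : TangentSpace (𝓡 m) x),
    mfderiv (𝓡 m) 𝓘(ℝ, ℝ) (fun y => (inner ℝ (μ y) u : ℝ)) x v =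
      Ω x ![fundamentalField m u x, v]

/-- The torus `U(1)^r` acts on `(M, Ω)` in a Hamiltonian fashion: the action is smooth,
preserves `Ω`, and admits a moment map. -/
structure IsHamiltonianAction (r : ℕ) [MulAction (Torus r) M] (Ω : TwoForm m M) : Prop where
  smooth : ContMDiffSMul (torusModel r) (𝓡 m) ∞ (Torus r) M
  preserves : ∀ (t : Torus r) (x : M) (v w : TangentSpace (𝓡 m) x),
    Ω (t • x) ![actionDeriv m t x v, actionDeriv m t x w] = Ω x ![v, w]
  exists_momentMap : ∃ μ : M → EuclideanSpace ℝ (Fin r), IsMomentMap Ω μ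

/-- The isotropy representation of the torus on the tangent space at a fixed point `p`.
(As `t • p = p`, the differential of `t` at `p` is an endomorphism of the tangent space at `p`.) -/
def isotropyRep (m : ℕ) {M : Type*} [TopologicalSpace M]
    [ChartedSpace (EuclideanSpace ℝ (Fin m)) M] {r : ℕ} [MulAction (Torus r) M]
    (p : MulAction.fixedPoints (Torus r) M) (t : Torus r) :
    TangentSpace (𝓡 m) (p : M) →L[ℝ] TangentSpace (𝓡 m) (p : M) :=
  actionDeriv m t (p : M)

/-- `I` is a complex structure on the tangent space at the fixed point `p` which is compatible
with `Ω` and invariant under the isotropy representation. -/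
structure IsInvariantCompatible (Ω : TwoForm m M) (p : MulAction.fixedPoints (Torus r) M)
    (I : TangentSpace (𝓡 m) (p : M) →L[ℝ] TangentSpace (𝓡 m) (p : M)) : Prop where
  sq_eq_neg : ∀ v, I (I v) = -v
  symplectic : ∀ v w, Ω p ![I v, I w] = Ω p ![v, w]
  pos : ∀ v, v ≠ 0 → 0 < Ω p ![v, I v]
  equivariant : ∀ (t : Torus r) v, I (isotropyRep m p t v) = isotropyRep m p t (I v)

/-- The set of weights `a ∈ ℤ^r` of the isotropy representation at the fixed point `p`: the
tangent space is a complex representation by means of an invariant compatible complex structure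
`I`, and `a` is a weight if there is a nonzero vector `v` on which each `t` acts as
multiplication by the complex number `t^a`. (The weights do not depend on the choice of `I`.) -/
def isotropyWeights (Ω : TwoForm m M) (p : MulAction.fixedPoints (Torus r) M) :
    Set (Fin r → ℤ) :=
  {a | ∃ I : TangentSpace (𝓡 m) (p : M) →L[ℝ] TangentSpace (𝓡 m) (p : M),
    IsInvariantCompatible Ω p I ∧
    ∃ v : TangentSpace (𝓡 m) (p : M), v ≠ 0 ∧ ∀ t : Torus r,
      isotropyRep m p t v =
        (torusChar a t : ℂ).re • v + (torusChar a t : ℂ).im • I v}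

end Symplectic

end

/-! Suppose `u` pairs positively with all weights. By compactness the Hamiltonian `⟨μ, u⟩` has a
maximum, and the maximum is attained at a fixed point of the whole torus
(`exists_fixedPoint_isMax`). For `u` with rationally independent entries, nondegeneracy makes a
maximum a zero of the fundamental field, hence a fixed point of the one-parameter subgroup; a
continuous function on the torus invariant under such a flow is constant by Fourier series, so the
torus fixes the point too. A general `u` is a limit of such vectors, and the fixed point set is
compact.

At such a point `p` there is at least one weight. Averaging gives an invariant inner product, polar
decomposition of `Ω p` relative to it an invariant compatible `I`, and the commuting operators of
the isotropy representation have a joint complex eigenvector `v`, whose eigenvalue is a continuous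
character `t ↦ t^a` (`exists_weight_of_symplectic_representation`).

The field of `u` linearizes at `p` to `v ↦ -⟨u, a⟩ I v`, so the second derivative of `⟨μ, u⟩` along
`v` is `⟨u, a⟩ Ω(v, I v)`. At a maximum it is nonpositive, while `Ω(v, I v) > 0`; thus `⟨u, a⟩ ≤ 0`
(`inner_latticeVec_nonpos_of_isMax`), a contradiction. -/

/-! ### Fourier series on the torus. -/

section Kronecker

open MeasureTheory

-- `mFourierCoeff` integrates against Haar probability measure; with these instances `volume` is
-- that measure, and translation invariance applies.
noncomputable local instance : MeasureSpace UnitAddCircle := ⟨AddCircle.haarAddCircle⟩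

local instance : Measure.IsAddHaarMeasure (volume : Measure UnitAddCircle) :=
  inferInstanceAs (Measure.IsAddHaarMeasure AddCircle.haarAddCircle)

local instance : IsProbabilityMeasure (volume : Measure UnitAddCircle) :=
  inferInstanceAs (IsProbabilityMeasure AddCircle.haarAddCircle)

/-- A monomial on the torus is multiplicative. -/
lemma UnitAddTorus.mFourier_apply_add {d : Type*} [Fintype d] (n : d → ℤ) (x y : UnitAddTorus d) :
    mFourier n (x + y) = mFourier n x * mFourier n y := by
  simp [mFourier, fourier_apply, smul_add, AddCircle.toCircle_add, Finset.prod_mul_distrib]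

lemma UnitAddTorus.mFourier_coe {d : Type*} [Fintype d] (n : d → ℤ) (x : d → ℝ) :
    mFourier n (fun k => (x k : UnitAddCircle)) =
      Complex.exp (2 * Real.pi * Complex.I * ((∑ k, n k * x k : ℝ) : ℂ)) := by
  simp only [mFourier, ContinuousMap.coe_mk, fourier_coe_apply]
  rw [← Complex.exp_sum]
  congr 1
  push_cast
  rw [Finset.mul_sum]
  refine Finset.sum_congr rfl fun k _ => ?_
  simp
  ring

/-- Translating the integral along the flow leaves `f` alone and multiplies the monomial by a phase.
At half a period, `s = 1 / (2c)`, the phase is `-1`, so the coefficient equals its negative. -/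
lemma UnitAddTorus.mFourierCoeff_eq_zero_of_forall_add {d : Type*} [Fintype d]
    (f : UnitAddTorus d → ℂ) (w : d → ℝ)
    (hf : ∀ (s : ℝ) (x : UnitAddTorus d), f (x + fun k => ((s * w k : ℝ) : UnitAddCircle)) = f x)
    (n : d → ℤ) (hn : ∑ k, n k * w k ≠ 0) : mFourierCoeff f n = 0 := by
  set c : ℝ := ∑ k, n k * w k with hc
  set s : ℝ := 1 / (2 * c) with hs
  set e : UnitAddTorus d := fun k => ((s * w k : ℝ) : UnitAddCircle) with he
  have hsum : ∑ k, ((-n) k : ℝ) * (s * w k) = -(1 / 2) := by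
    have : ∑ k, ((-n) k : ℝ) * (s * w k) = -(s * c) := by
      rw [hc, Finset.mul_sum, ← Finset.sum_neg_distrib]
      exact Finset.sum_congr rfl fun k _ => by push_cast [Pi.neg_apply]; ring
    rw [this, hs]
    field_simp
  have hchar : mFourier (-n) e = -1 := by
    have h := UnitAddTorus.mFourier_coe (-n) (fun k => s * w k)
    rw [hsum] at h
    rw [he, h]
    rw [show (2 * Real.pi * Complex.I * ((-(1 / 2) : ℝ) : ℂ) : ℂ) = -(Real.pi * Complex.I) by
      push_cast; ring]
    rw [Complex.exp_neg, Complex.exp_pi_mul_I]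
    norm_num
  have key : mFourierCoeff f n = -mFourierCoeff f n := by
    unfold mFourierCoeff
    refine (integral_add_right_eq_self (μ := volume)
      (fun t => mFourier (-n) t • f t) e).symm.trans ?_
    rw [← integral_neg]
    refine integral_congr_ae (Filter.Eventually.of_forall fun t => ?_)
    have hft : f (t + e) = f t := hf s t
    simp only [UnitAddTorus.mFourier_apply_add, hchar, hft]
    simp
  exact self_eq_neg.mp key

/-- A continuous function on the torus which is invariant under a linear flow with rationally
independent frequencies is constant. -/
theorem UnitAddTorus.eq_of_forall_add {d : Type*} [Fintype d]
    (f : C(UnitAddTorus d, ℂ)) (w : d → ℝ)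
    (hw : ∀ a : d → ℤ, a ≠ 0 → ∑ k, a k * w k ≠ 0)
    (hf : ∀ (s : ℝ) (x : UnitAddTorus d), f (x + fun k => ((s * w k : ℝ) : UnitAddCircle)) = f x)
    (x y : UnitAddTorus d) : f x = f y := by
  have h0 : ∀ n : d → ℤ, n ≠ 0 → mFourierCoeff f n = 0 := fun n hn =>
    UnitAddTorus.mFourierCoeff_eq_zero_of_forall_add f w hf n (hw n hn)
  -- Only the constant term survives, so the series converges pointwise to `f`.
  have hs : Summable (mFourierCoeff f) :=
    summable_of_ne_finset_zero (s := {0}) fun n hn => h0 n (by simpa using hn)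
  have key : ∀ z, f z = mFourierCoeff f 0 := by
    intro z
    have h1 := hasSum_mFourier_series_apply_of_summable hs z
    have h2 := hasSum_single (f := fun i => mFourierCoeff f i • mFourier i z) 0
      fun n hn => by simp [h0 n hn]
    rw [h1.unique h2]
    simp [mFourier_zero]
  rw [key, key]

/-- A continuous character of the torus is a monomial. -/
theorem UnitAddTorus.exists_eq_mFourier {d : Type*} [Fintype d] (f : C(UnitAddTorus d, ℂ))
    (h0 : f 0 = 1) (hadd : ∀ x y, f (x + y) = f x * f y) : ∃ n : d → ℤ, f = mFourier n := by
  -- If all coefficients vanished, the series would give `f 0 = 0`.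
  have hne : ∃ n, mFourierCoeff f n ≠ 0 := by
    by_contra! h
    have h1 := hasSum_mFourier_series_apply_of_summable (f := f)
      (summable_of_ne_finset_zero (s := ∅) fun n _ => h n) 0
    simp only [h, zero_smul] at h1
    exact one_ne_zero (h0.symm.trans (h1.unique hasSum_zero))
  obtain ⟨n, hn⟩ := hne
  refine ⟨n, ContinuousMap.ext fun y => ?_⟩
  -- Translation by `y` rescales the nonzero coefficient by `mFourier (-n) y * f y`, which must
  -- therefore be `1`.
  have key : mFourierCoeff f n = mFourier (-n) y * f y * mFourierCoeff f n := by
    unfold mFourierCoeff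
    refine (integral_add_right_eq_self (μ := volume)
      (fun t => mFourier (-n) t • f t) y).symm.trans ?_
    rw [← integral_const_mul]
    refine integral_congr_ae (Filter.Eventually.of_forall fun t => ?_)
    simp only [UnitAddTorus.mFourier_apply_add, hadd, smul_eq_mul]
    ring
  have h1 : mFourier (-n) y * f y = 1 := mul_right_cancel₀ hn (by rw [one_mul]; exact key.symm)
  have h2 : mFourier n y * mFourier (-n) y = 1 := by
    rw [← mFourier_add, add_neg_cancel, mFourier_zero]; rfl
  calc f y = mFourier n y * mFourier (-n) y * f y := by rw [h2, one_mul]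
    _ = mFourier n y := by rw [mul_assoc, h1, mul_one]

end Kronecker

/-! ### Characters of the torus and generic one-parameter subgroups. -/

lemma AddCircle.toCircle_one_surjective :
    Function.Surjective (AddCircle.toCircle : UnitAddCircle → Circle) := by
  intro z
  refine ⟨((Complex.arg z / (2 * Real.pi) : ℝ) : UnitAddCircle), ?_⟩
  rw [AddCircle.toCircle_apply_mk]
  rw [show 2 * Real.pi / 1 * (Complex.arg z / (2 * Real.pi)) = Complex.arg z by
    field_simp, Circle.exp_arg]

lemma torusChar_toCircle {r : ℕ} (a : Fin r → ℤ) (θ : UnitAddTorus (Fin r)) :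
    (torusChar a (fun k => AddCircle.toCircle (θ k)) : ℂ) = UnitAddTorus.mFourier a θ := by
  refine (map_prod Circle.coeHom _ _).trans ?_
  simp [UnitAddTorus.mFourier, fourier_apply, AddCircle.toCircle_zsmul]
  rfl

/-- The continuous characters of the torus are the `torusChar a`. -/
theorem exists_eq_torusChar {r : ℕ} (χ : Torus r → ℂ) (hχ : Continuous χ) (h1 : χ 1 = 1)
    (hmul : ∀ s t, χ (s * t) = χ s * χ t) : ∃ a : Fin r → ℤ, ∀ t, χ t = torusChar a t := by
  have hcont : Continuous fun θ : UnitAddTorus (Fin r) =>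
      χ (fun k => AddCircle.toCircle (θ k)) :=
    hχ.comp (continuous_pi fun k => AddCircle.continuous_toCircle.comp (continuous_apply k))
  obtain ⟨a, ha⟩ := UnitAddTorus.exists_eq_mFourier ⟨_, hcont⟩
    (by simp only [ContinuousMap.coe_mk, Pi.zero_apply, AddCircle.toCircle_zero]; exact h1) fun x y => by
      simp only [ContinuousMap.coe_mk, Pi.add_apply, AddCircle.toCircle_add]
      exact hmul _ _
  refine ⟨a, fun t => ?_⟩
  choose φ hφ using AddCircle.toCircle_one_surjective
  have h := DFunLike.congr_fun ha fun k => φ (t k)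
  rw [← torusChar_toCircle] at h
  simpa only [ContinuousMap.coe_mk, hφ] using h

/-- A point fixed by a one-parameter subgroup of the torus with rationally independent
frequencies is fixed by the torus. -/
theorem smul_eq_of_forall_torusExp_smul_eq {r : ℕ} {M : Type*} [TopologicalSpace M] [T2Space M]
    [CompactSpace M] [MulAction (Torus r) M] [ContinuousSMul (Torus r) M]
    (w : EuclideanSpace ℝ (Fin r)) (hw : ∀ a : Fin r → ℤ, a ≠ 0 → ∑ k, a k * w k ≠ 0)
    (x : M) (hx : ∀ s : ℝ, torusExp (s • w) • x = x) (t : Torus r) : t • x = x := by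
  by_contra hne
  -- A Urysohn function separating `x` from `t • x`, pulled back along the orbit map, is
  -- flow-invariant and hence constant.
  obtain ⟨g, hg0, hg1, -⟩ := exists_continuous_zero_one_of_isClosed
    (isClosed_singleton (x := x)) (isClosed_singleton (x := t • x))
    (by simpa using Ne.symm hne)
  have hcont : Continuous fun θ : UnitAddTorus (Fin r) =>
      ((g ((fun k => AddCircle.toCircle (θ k) : Torus r) • x) : ℝ) : ℂ) := by
    refine Complex.continuous_ofReal.comp (g.continuous.comp ?_)
    refine Continuous.smul (continuous_pi fun k => ?_) continuous_const
    exact AddCircle.continuous_toCircle.comp (continuous_apply k)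
  have hinv := UnitAddTorus.eq_of_forall_add ⟨_, hcont⟩ w hw (fun s θ => by
    -- The factor `2π` converts between period `1` of `UnitAddCircle` and period `2π` of
    -- `Circle.exp`.
    have h1 : (fun k => AddCircle.toCircle ((θ + fun k => ((s * w k : ℝ) : UnitAddCircle)) k) :
        Torus r) = (fun k => AddCircle.toCircle (θ k) : Torus r) *
          torusExp ((2 * Real.pi * s) • w) := by
      funext k
      simp [torusExp, AddCircle.toCircle_add, AddCircle.toCircle_apply_mk, mul_assoc]
    rw [ContinuousMap.coe_mk, h1, mul_smul _ (torusExp _) x, hx])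
  choose φ hφ using AddCircle.toCircle_one_surjective
  have h := hinv (fun k => φ (t k)) 0
  simp only [ContinuousMap.coe_mk, hφ, Pi.zero_apply, AddCircle.toCircle_zero] at h
  rw [show ((fun _ => 1 : Torus r)) = 1 from rfl, one_smul, hg0 rfl, hg1 rfl] at h
  simp at h

/-- Rationally independent frequency vectors are dense. -/
theorem dense_setOf_rationally_independent (r : ℕ) :
    Dense {w : EuclideanSpace ℝ (Fin r) | ∀ a : Fin r → ℤ, a ≠ 0 → ∑ k, a k * w k ≠ 0} := by
  have : {w : EuclideanSpace ℝ (Fin r) | ∀ a : Fin r → ℤ, a ≠ 0 → ∑ k, a k * w k ≠ 0} =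
      ⋂ a : {a : Fin r → ℤ // a ≠ 0}, {w : EuclideanSpace ℝ (Fin r) | ∑ k, (a.1 k : ℝ) * w k ≠ 0} := by
    ext w; simp
  rw [this]
  -- Baire: there are countably many integer vectors, and each excludes only a hyperplane.
  refine dense_iInter_of_isOpen (fun a => ?_) fun a => ?_
  · exact isOpen_ne_fun (by fun_prop) continuous_const
  · intro w
    obtain ⟨k, hk⟩ := Function.ne_iff.mp a.2
    rw [mem_closure_iff_seq_limit]
    by_cases h0 : ∑ k, (a.1 k : ℝ) * w k = 0
    · refine ⟨fun n => w + (1 / ((n : ℝ) + 1)) • EuclideanSpace.single k 1, fun n => ?_, ?_⟩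
      · have hn : ((n : ℝ) + 1) ≠ 0 := by positivity
        have : (a.1 k : ℝ) ≠ 0 := by exact_mod_cast hk
        simp [mul_add, Finset.sum_add_distrib, h0, this, hn]
      · have := (tendsto_one_div_add_atTop_nhds_zero_nat (𝕜 := ℝ)).smul_const
          (EuclideanSpace.single k (1 : ℝ))
        simpa using this.const_add w
    · exact ⟨fun _ => w, fun _ => h0, tendsto_const_nhds⟩

/-! ### Joint eigenvectors and compatible complex structures. -/

section LinearAlgebra

open Module

/-- A commuting family of endomorphisms of a nonzero finite-dimensional complex vector space has
a joint eigenvector. -/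
theorem Module.End.exists_joint_eigenvector {V ι : Type*} [AddCommGroup V] [Module ℂ V]
    [FiniteDimensional ℂ V] [Nontrivial V] (f : ι → End ℂ V) (hf : ∀ i j, Commute (f i) (f j)) :
    ∃ v : V, v ≠ 0 ∧ ∃ χ : ι → ℂ, ∀ i, f i v = χ i • v := by
  -- On a nonzero invariant subspace of least dimension every `f i` is a scalar, since its
  -- eigenspaces are invariant under the commuting family.
  have hex : ∃ d : ℕ, ∃ W : Submodule ℂ V, W ≠ ⊥ ∧ (∀ i, ∀ w ∈ W, f i w ∈ W) ∧
      finrank ℂ W = d := ⟨_, ⊤, top_ne_bot, fun _ _ _ => Submodule.mem_top, rfl⟩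
  classical
  obtain ⟨W, hW0, hWf, hWd⟩ := Nat.find_spec hex
  have hmin : ∀ W' : Submodule ℂ V, W' ≤ W → W' ≠ ⊥ → (∀ i, ∀ w ∈ W', f i w ∈ W') → W' = W := by
    intro W' hle h0 hinv
    refine Submodule.eq_of_le_of_finrank_le hle ?_
    rw [hWd]
    exact Nat.find_min' hex ⟨W', h0, hinv, rfl⟩
  have hchar : ∀ i, ∃ μ : ℂ, ∀ w ∈ W, f i w = μ • w := by
    intro i
    have : Nontrivial W := Submodule.nontrivial_iff_ne_bot.mpr hW0
    obtain ⟨μ, hμ⟩ := Module.End.exists_eigenvalue ((f i).restrict (hWf i))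
    obtain ⟨w, hw⟩ := hμ.exists_hasEigenvector
    have hE : W ⊓ (f i).eigenspace μ = W := by
      refine hmin _ inf_le_left ?_ ?_
      · rw [Submodule.ne_bot_iff]
        refine ⟨w, ⟨w.2, ?_⟩, by simpa using hw.2⟩
        refine Module.End.mem_eigenspace_iff.mpr ?_
        simpa using congrArg Subtype.val hw.apply_eq_smul
      · rintro j x ⟨hx, hxe⟩
        refine ⟨hWf j x hx, ?_⟩
        have hxe' := Module.End.mem_eigenspace_iff.mp hxe
        refine Module.End.mem_eigenspace_iff.mpr ?_
        have := LinearMap.congr_fun (hf i j) x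
        simp only [Module.End.mul_apply] at this
        rw [this, hxe', map_smul]
    refine ⟨μ, fun x hx => ?_⟩
    rw [← hE] at hx
    exact Module.End.mem_eigenspace_iff.mp hx.2
  choose χ hχ using hchar
  obtain ⟨v, hv, hv0⟩ := Submodule.exists_mem_ne_zero_of_ne_bot hW0
  exact ⟨v, hv0, χ, fun i => hχ i v hv⟩

/-- A commuting family of endomorphisms of a nonzero real vector space which commute with a
complex structure `I` has a joint complex eigenvector. -/
theorem exists_joint_eigenvector_of_complexStructure {V ι : Type*} [AddCommGroup V] [Module ℝ V]
    [FiniteDimensional ℝ V] [Nontrivial V] (I : End ℝ V) (hI : I * I = -1)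
    (f : ι → End ℝ V) (hf : ∀ i j, Commute (f i) (f j)) (hfI : ∀ i, Commute (f i) I) :
    ∃ v : V, v ≠ 0 ∧ ∃ χ : ι → ℂ, ∀ i, f i v = (χ i).re • v + (χ i).im • I v := by
  let φ : ℂ →ₐ[ℝ] End ℝ V := Complex.lift ⟨I, hI⟩
  let : Module ℂ V := Module.compHom V φ.toRingHom
  have hsmul : ∀ (z : ℂ) (v : V), z • v = z.re • v + z.im • I v := by
    intro z v
    change φ z v = _
    simp [φ, Complex.liftAux_apply]
  have : IsScalarTower ℝ ℂ V := ⟨fun x z v => by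
    simp [hsmul, smul_add, mul_smul]⟩
  have : FiniteDimensional ℂ V := Module.Finite.of_restrictScalars_finite ℝ ℂ V
  let F : ι → End ℂ V := fun i =>
    { toFun := f i
      map_add' := (f i).map_add
      map_smul' := fun z v => by
        have h : f i (I v) = I (f i v) := LinearMap.congr_fun (hfI i) v
        simp [hsmul, h] }
  obtain ⟨v, hv, χ, hχ⟩ := Module.End.exists_joint_eigenvector F fun i j => by
    ext v
    exact LinearMap.congr_fun (hf i j) v
  exact ⟨v, hv, χ, fun i => by rw [← hsmul]; exact hχ i⟩

/-- A symmetric positive definite operator `S` has an inverse fourth root which is a symmetric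
polynomial in `S`. -/
theorem LinearMap.IsSymmetric.exists_aeval_pow_four_mul_eq_one {V : Type*} [NormedAddCommGroup V]
    [InnerProductSpace ℝ V] [FiniteDimensional ℝ V] (S : End ℝ V) (hS : S.IsSymmetric)
    (hpos : ∀ v, v ≠ 0 → 0 < inner ℝ (S v) v) :
    ∃ P : Polynomial ℝ, (Polynomial.aeval S P).IsSymmetric ∧
      (Polynomial.aeval S P) ^ 4 * S = 1 := by
  classical
  set b := hS.eigenvectorBasis rfl
  set l := hS.eigenvalues rfl
  have hvec : ∀ i, S (b i) = l i • b i := hS.apply_eigenvectorBasis rfl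
  have hl : ∀ i, 0 < l i := by
    intro i
    have h := hpos (b i) (b.orthonormal.ne_zero i)
    rw [hvec, inner_smul_left, real_inner_self_eq_norm_sq, b.orthonormal.norm_eq_one] at h
    simpa using h
  -- Interpolates `x ↦ x^(-1/4)` on the spectrum. A polynomial in `S` commutes with whatever
  -- commutes with `S`.
  let P : Polynomial ℝ :=
    Lagrange.interpolate (Finset.univ.image l) _root_.id fun x => (√(√x))⁻¹
  have hP : ∀ i, P.eval (l i) = (√(√(l i)))⁻¹ := fun i =>
    Lagrange.eval_interpolate_at_node (v := _root_.id) _ (Function.injective_id.injOn)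
      (Finset.mem_image_of_mem _ (Finset.mem_univ i))
  have hPb : ∀ i, Polynomial.aeval S P (b i) = (√(√(l i)))⁻¹ • b i := by
    intro i
    rw [Module.End.aeval_apply_of_hasEigenvector (μ := l i), hP]
    exact ⟨Module.End.mem_eigenspace_iff.mpr (hvec i), b.orthonormal.ne_zero i⟩
  refine ⟨P, ?_, ?_⟩
  · have hQ : ∀ Q : Polynomial ℝ, (Polynomial.aeval S Q).IsSymmetric := by
      intro Q
      induction Q using Polynomial.induction_on with
      | C a => intro v w; simp [Polynomial.aeval_C, Module.algebraMap_end_apply, inner_smul_left,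
          inner_smul_right]
      | add p q hp hq =>
        rw [map_add]
        exact hp.add hq
      | monomial k a h =>
        have hk : (S ^ (k + 1)).IsSymmetric := hS.pow _
        intro v w
        have := hk v w
        simp [Polynomial.aeval_C, Module.algebraMap_end_apply, inner_smul_left,
          inner_smul_right, this]
    exact hQ P
  · refine b.toBasis.ext fun i => ?_
    have h4 : (√(√(l i)))⁻¹ ^ 4 * l i = 1 := by
      have h1 : (√(√(l i))) ^ 4 = l i := by
        rw [show (4 : ℕ) = 2 * 2 from rfl, pow_mul, Real.sq_sqrt (Real.sqrt_nonneg _),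
          Real.sq_sqrt (hl i).le]
      rw [inv_pow, h1, inv_mul_cancel₀ (hl i).ne']
    simp only [OrthonormalBasis.coe_toBasis, Module.End.mul_apply, hvec, map_smul,
      Module.End.one_apply, pow_succ, pow_zero, one_mul, hPb, smul_smul]
    convert one_smul ℝ (b i) using 2
    rw [← h4]; ring

/-- A real symplectic vector space with an inner product `g` has a compatible complex structure
which is orthogonal and commutes with all symplectic orthogonal transformations. -/
theorem exists_compatible_complexStructure {V : Type*} [AddCommGroup V] [Module ℝ V]
    [FiniteDimensional ℝ V] (g σ : V →ₗ[ℝ] V →ₗ[ℝ] ℝ)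
    (hgs : ∀ v w, g v w = g w v) (hgp : ∀ v, v ≠ 0 → 0 < g v v)
    (hσ : ∀ v w, σ v w = -σ w v) (hnd : ∀ v, (∀ w, σ v w = 0) → v = 0) :
    ∃ I : End ℝ V, I * I = -1 ∧ (∀ v w, σ (I v) (I w) = σ v w) ∧
      (∀ v, v ≠ 0 → 0 < σ v (I v)) ∧ (∀ v w, g (I v) (I w) = g v w) ∧
      ∀ A : End ℝ V, (∀ v w, g (A v) (A w) = g v w) → (∀ v w, σ (A v) (A w) = σ v w) →
        Commute A I := by
  have hnn : ∀ v, 0 ≤ g v v := fun v => by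
    rcases eq_or_ne v 0 with rfl | h
    · simp
    · exact (hgp v h).le
  let core : InnerProductSpace.Core ℝ V :=
    { inner := fun v w => g v w
      conj_inner_symm := fun v w => by simp [hgs v w]
      re_inner_nonneg := fun v => by simpa using hnn v
      add_left := fun v w z => by simp
      smul_left := fun v w z => by simp
      definite := fun v h => by
        by_contra h0
        exact (hgp v h0).ne' h }
  let : NormedAddCommGroup V := core.toNormedAddCommGroup
  let : InnerProductSpace ℝ V := InnerProductSpace.ofCore core.toCore
  have hin : ∀ v w : V, inner ℝ v w = g v w := fun v w => rfl
  let B : End ℝ V :=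
    { toFun := fun v => (InnerProductSpace.toDual ℝ V).symm (LinearMap.toContinuousLinearMap (σ v))
      map_add' := fun v w => by simp
      map_smul' := fun c v => by simp }
  have hB : ∀ v w, g (B v) w = σ v w := fun v w => by
    rw [← hin]
    exact InnerProductSpace.toDual_symm_apply
  have hext : ∀ v w, (∀ z, g v z = g w z) → v = w := fun v w h =>
    ext_inner_right ℝ h
  have hBskew : ∀ v w, g (B v) w = -g v (B w) := fun v w => by
    rw [hB, hgs v, hB, hσ]
  have hBinj : ∀ v, B v = 0 → v = 0 := fun v h => hnd v fun w => by rw [← hB, h]; simp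
  -- `B` is skew for `g`, so `S = BᵀB` is positive definite.
  let S : End ℝ V := -(B * B)
  have hS : S.IsSymmetric := fun v w => by
    simp only [hin, S, LinearMap.neg_apply, Module.End.mul_apply, map_neg]
    rw [hBskew, hBskew v, neg_neg]
  have hSpos : ∀ v, v ≠ 0 → 0 < inner ℝ (S v) v := fun v hv => by
    simp only [hin, S, LinearMap.neg_apply, Module.End.mul_apply, map_neg]
    rw [hBskew, neg_neg]
    exact hgp _ fun h => hv (hBinj v h)
  obtain ⟨P, hQsymm, hQ4⟩ := hS.exists_aeval_pow_four_mul_eq_one S hSpos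
  set Q := Polynomial.aeval S P with hQdef
  have hcomm : ∀ A : End ℝ V, Commute A B → Commute A Q := fun A hA => by
    have hAS : Commute A S := (hA.mul_right hA).neg_right
    rw [hQdef, Polynomial.aeval_eq_sum_range]
    exact Commute.sum_right _ _ _ fun k _ => (hAS.pow_right k).smul_right _
  have hBQ : Commute B Q := hcomm B (Commute.refl B)
  have hQS : Commute Q S := ((hBQ.mul_left hBQ).neg_left).symm
  have hQ4' : Q * Q * (Q * Q) * S = 1 := by rw [← hQ4]; simp [pow_succ, mul_assoc]
  have hQinj : ∀ v, Q v = 0 → v = 0 := fun v h => by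
    have h1 : Q * Q * Q * S * Q = 1 := by
      rw [mul_assoc _ S Q, ← hQS.eq, ← hQ4']; simp only [mul_assoc]
    have := LinearMap.congr_fun h1 v
    simpa [h] using this.symm
  have hQs : ∀ v w, g (Q v) w = g v (Q w) := hQsymm
  -- `B S^(-1/2)`, the orthogonal factor in the polar decomposition of `B`.
  let I : End ℝ V := B * (Q * Q)
  have hIB : Commute B I := (Commute.refl B).mul_right (hBQ.mul_right hBQ)
  have hII : I * I = -1 := by
    have : I * I = Q * Q * (Q * Q) * (B * B) := by
      have h2 : Commute B (Q * Q) := hBQ.mul_right hBQ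
      calc I * I = B * ((Q * Q) * B) * (Q * Q) := by simp only [I, mul_assoc]
        _ = B * (B * (Q * Q)) * (Q * Q) := by rw [h2.eq]
        _ = (B * B) * (Q * Q * (Q * Q)) := by simp only [mul_assoc]
        _ = _ := ((h2.mul_right h2).mul_left (h2.mul_right h2)).eq
    rw [this, ← hQ4']
    simp [S]
  have hIskew : ∀ v w, g (I v) w = -g v (I w) := fun v w => by
    have h2 : B * (Q * Q) = Q * Q * B := (hBQ.mul_right hBQ).eq
    have e1 : I v = B (Q (Q v)) := rfl
    have e2 : I w = Q (Q (B w)) := LinearMap.congr_fun h2 w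
    rw [e1, e2, hBskew, hQs, hQs]
  have hIorth : ∀ v w, g (I v) (I w) = g v w := fun v w => by
    have h3 : I (I w) = -w := LinearMap.congr_fun hII w
    rw [hIskew, h3]; simp
  refine ⟨I, hII, fun v w => ?_, fun v hv => ?_, hIorth, fun A hAg hAσ => ?_⟩
  · have h3 : B (I v) = I (B v) := LinearMap.congr_fun hIB.eq v
    rw [← hB, h3, hIorth, hB]
  -- `σ(v, I v) = g(S v, Q² v) = g(S Q v, Q v)`: the fourth root lets `Q` be split evenly between
  -- both arguments.
  · have e1 : I v = B (Q (Q v)) := rfl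
    have e2 : g (B v) (B (Q (Q v))) = g (S v) (Q (Q v)) := by
      have : g (B (B v)) (Q (Q v)) = -g (B v) (B (Q (Q v))) := hBskew _ _
      simp [S, this]
    rw [← hB, e1, e2, ← hQs, show Q (S v) = S (Q v) from LinearMap.congr_fun hQS.eq v]
    exact hSpos (Q v) fun h => hv (hQinj v h)
  · have hAinj : Function.Injective A := by
      rw [← LinearMap.ker_eq_bot, LinearMap.ker_eq_bot']
      intro v hv
      by_contra h0
      have := hAg v v
      rw [hv] at this
      exact (hgp v h0).ne' (by rw [← this]; simp)
    have hAsurj : Function.Surjective A := LinearMap.surjective_of_injective hAinj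
    -- `B` is determined by `g` and `σ`, both of which `A` preserves.
    have hAB : Commute A B := by
      ext v
      refine hext _ _ fun z => ?_
      obtain ⟨w, rfl⟩ := hAsurj z
      simp only [Module.End.mul_apply]
      rw [hAg, hB, hB, hAσ]
    exact hAB.mul_right ((hcomm A hAB).mul_right (hcomm A hAB))

end LinearAlgebra

/-! ### Invariant inner products and weight vectors. -/

section Representation

open MeasureTheory

/-- A continuous representation of a compact commutative group on a Euclidean space has an
invariant inner product. -/
theorem exists_invariant_inner {G V : Type*} [CommGroup G] [TopologicalSpace G]
    [IsTopologicalGroup G] [CompactSpace G] [NormedAddCommGroup V] [InnerProductSpace ℝ V]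
    (ρ : G → V →L[ℝ] V) (h1 : ∀ v, ρ 1 v = v) (hmul : ∀ s t v, ρ (s * t) v = ρ s (ρ t v))
    (hcont : ∀ v, Continuous fun t => ρ t v) :
    ∃ g : V →ₗ[ℝ] V →ₗ[ℝ] ℝ, (∀ v w, g v w = g w v) ∧ (∀ v, v ≠ 0 → 0 < g v v) ∧
      ∀ t v w, g (ρ t v) (ρ t w) = g v w := by
  let : MeasurableSpace G := borel G
  have : BorelSpace G := ⟨rfl⟩
  let μ : Measure G := Measure.haar
  have hc : ∀ v w, Continuous fun t => (inner ℝ (ρ t v) (ρ t w) : ℝ) := fun v w =>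
    (hcont v).inner (hcont w)
  have hi : ∀ v w, Integrable (fun t => (inner ℝ (ρ t v) (ρ t w) : ℝ)) μ := fun v w =>
    (hc v w).integrable_of_hasCompactSupport (HasCompactSupport.of_compactSpace _)
  -- The average of the given inner product over Haar measure.
  refine ⟨LinearMap.mk₂ ℝ (fun v w => ∫ t, (inner ℝ (ρ t v) (ρ t w) : ℝ) ∂μ) ?_ ?_ ?_ ?_,
    ?_, ?_, ?_⟩
  · intro v v' w
    simp only [map_add, inner_add_left]
    exact integral_add (hi v w) (hi v' w)
  · intro c v w
    simp only [map_smul, real_inner_smul_left, smul_eq_mul]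
    exact integral_const_mul _ _
  · intro v w w'
    simp only [map_add, inner_add_right]
    exact integral_add (hi v w) (hi v w')
  · intro c v w
    simp only [map_smul, real_inner_smul_right, smul_eq_mul]
    exact integral_const_mul _ _
  · intro v w
    simp only [LinearMap.mk₂_apply, real_inner_comm]
  · intro v hv
    rw [LinearMap.mk₂_apply]
    refine (hc v v).integral_pos_of_hasCompactSupport_nonneg_nonzero
      (HasCompactSupport.of_compactSpace _) (fun t => real_inner_self_nonneg) (x := 1) ?_
    simpa [h1] using hv
  · intro t v w
    simp only [LinearMap.mk₂_apply, ← hmul]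
    exact integral_mul_right_eq_self (fun s => (inner ℝ (ρ s v) (ρ s w) : ℝ)) t

/-- A nonzero continuous symplectic representation of the torus has an invariant compatible
complex structure and a weight vector. -/
theorem exists_weight_of_symplectic_representation {r : ℕ} {V : Type*} [NormedAddCommGroup V]
    [InnerProductSpace ℝ V] [FiniteDimensional ℝ V] [Nontrivial V]
    (ρ : Torus r → V →L[ℝ] V) (h1 : ∀ v, ρ 1 v = v) (hmul : ∀ s t v, ρ (s * t) v = ρ s (ρ t v))
    (hcont : ∀ v, Continuous fun t => ρ t v) (σ : V →ₗ[ℝ] V →ₗ[ℝ] ℝ)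
    (hσ : ∀ v w, σ v w = -σ w v) (hnd : ∀ v, (∀ w, σ v w = 0) → v = 0)
    (hinv : ∀ t v w, σ (ρ t v) (ρ t w) = σ v w) :
    ∃ I : V →L[ℝ] V, (∀ v, I (I v) = -v) ∧ (∀ v w, σ (I v) (I w) = σ v w) ∧
      (∀ v, v ≠ 0 → 0 < σ v (I v)) ∧ (∀ t v, I (ρ t v) = ρ t (I v)) ∧
      ∃ (a : Fin r → ℤ) (v : V), v ≠ 0 ∧ ∀ t, ρ t v =
        (torusChar a t : ℂ).re • v + (torusChar a t : ℂ).im • I v := by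
  obtain ⟨g, hgs, hgp, hginv⟩ := exists_invariant_inner ρ h1 hmul hcont
  obtain ⟨I, hII, hIσ, hIpos, hIg, hIcomm⟩ := exists_compatible_complexStructure g σ hgs hgp hσ hnd
  have hcomm : ∀ t, Commute (ρ t : V →ₗ[ℝ] V) I := fun t =>
    hIcomm _ (hginv t) (hinv t)
  obtain ⟨v, hv, χ, hχ⟩ := exists_joint_eigenvector_of_complexStructure I hII
    (fun t => (ρ t : V →ₗ[ℝ] V)) (fun s t => by
      ext v
      change ρ s (ρ t v) = ρ t (ρ s v)
      rw [← hmul, ← hmul, mul_comm]) hcomm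
  have hχ' : ∀ t, ρ t v = (χ t).re • v + (χ t).im • I v := hχ
  have hI2 : ∀ w, I (I w) = -w := fun w => LinearMap.congr_fun hII w
  have hIt : ∀ t w, I (ρ t w) = ρ t (I w) := fun t w => (LinearMap.congr_fun (hcomm t) w).symm
  have hgv := hgp v hv
  -- As `v` and `I v` are `g`-orthogonal of equal length, the eigenvalue is read off from inner
  -- products: it is unique and continuous in `t`.
  have hgI : g (I v) v = 0 := by
    have h := hIg v (I v)
    rw [hI2, map_neg, hgs v] at h
    linarith
  have hre : ∀ t, (χ t).re = g (ρ t v) v / g v v := fun t => by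
    rw [hχ', map_add, map_smul, map_smul, LinearMap.add_apply, LinearMap.smul_apply,
      LinearMap.smul_apply, hgI, smul_zero, add_zero, smul_eq_mul]
    field_simp
  have him : ∀ t, (χ t).im = g (ρ t v) (I v) / g v v := fun t => by
    rw [hχ', map_add, map_smul, map_smul, LinearMap.add_apply, LinearMap.smul_apply,
      LinearMap.smul_apply, hgs v, hgI, smul_zero, zero_add, hIg, smul_eq_mul]
    field_simp
  have hχcont : Continuous χ := by
    have hg : ∀ w, Continuous fun t => g (ρ t v) w := fun w =>
      (LinearMap.continuous_of_finiteDimensional (g.flip w)).comp (hcont v)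
    have : χ = fun t => (((g (ρ t v) v / g v v : ℝ) : ℂ) +
        ((g (ρ t v) (I v) / g v v : ℝ) : ℂ) * Complex.I) := by
      funext t
      rw [← hre, ← him, Complex.re_add_im]
    rw [this]
    exact (Complex.continuous_ofReal.comp ((hg v).div_const _)).add
      ((Complex.continuous_ofReal.comp ((hg (I v)).div_const _)).mul continuous_const)
  have huniq : ∀ (t : Torus r) (z : ℂ), ρ t v = z.re • v + z.im • I v → χ t = z := fun t z hz => by
    apply Complex.ext
    · rw [hre, hz, map_add, map_smul, map_smul, LinearMap.add_apply, LinearMap.smul_apply,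
        LinearMap.smul_apply, hgI, smul_zero, add_zero, smul_eq_mul]
      field_simp
    · rw [him, hz, map_add, map_smul, map_smul, LinearMap.add_apply, LinearMap.smul_apply,
        LinearMap.smul_apply, hgs v, hgI, smul_zero, zero_add, hIg, smul_eq_mul]
      field_simp
  obtain ⟨a, ha⟩ := exists_eq_torusChar χ hχcont (huniq 1 1 (by simp [h1])) fun s t => by
    apply huniq
    rw [hmul, hχ' t, map_add, map_smul, map_smul, ← hIt, hχ' s, map_add, map_smul, map_smul, hI2,
      Complex.mul_re, Complex.mul_im]
    module
  exact ⟨LinearMap.toContinuousLinearMap I, hI2, hIσ, hIpos, hIt, a, v, hv, fun t => by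
    rw [← ha t]; exact hχ' t⟩

end Representation

/-! ### The exponential map of the torus. -/

section TorusExp

/-- A map into a finite product of manifolds is smooth if its components are. -/
theorem contMDiff_pi_of_forall {𝕜 : Type*} [NontriviallyNormedField 𝕜] {ι : Type*} [Fintype ι]
    {E : ι → Type*} [∀ i, NormedAddCommGroup (E i)] [∀ i, NormedSpace 𝕜 (E i)] {H : ι → Type*}
    [∀ i, TopologicalSpace (H i)] (I : ∀ i, ModelWithCorners 𝕜 (E i) (H i))
    {M : ι → Type*} [∀ i, TopologicalSpace (M i)] [∀ i, ChartedSpace (H i) (M i)]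
    {E' : Type*} [NormedAddCommGroup E'] [NormedSpace 𝕜 E'] {H' : Type*} [TopologicalSpace H']
    {J : ModelWithCorners 𝕜 E' H'} {N : Type*} [TopologicalSpace N] [ChartedSpace H' N]
    {n : ℕ∞ω} {f : N → ∀ i, M i} (hf : ∀ i, ContMDiff J (I i) n fun x => f x i) :
    ContMDiff J (ModelWithCorners.pi I) n f := by
  intro x
  rw [contMDiffAt_iff]
  refine ⟨(continuous_pi fun i => (hf i).continuous).continuousAt, ?_⟩
  rw [contDiffWithinAt_pi]
  exact fun i => (contMDiffAt_iff.mp (hf i x)).2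

variable {r : ℕ}

lemma torusExp_add (u v : EuclideanSpace ℝ (Fin r)) :
    torusExp (u + v) = torusExp u * torusExp v := by
  funext k
  simp [torusExp, Circle.exp_add]

lemma torusExp_zero : torusExp (0 : EuclideanSpace ℝ (Fin r)) = 1 := by
  funext k
  simp [torusExp]

lemma contMDiff_torusExp :
    ContMDiff 𝓘(ℝ, EuclideanSpace ℝ (Fin r)) (torusModel r) ∞
      (torusExp : EuclideanSpace ℝ (Fin r) → Torus r) :=
  contMDiff_pi_of_forall _ fun k =>
    contMDiff_circleExp.comp (ContDiff.contMDiff (by fun_prop))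

lemma contMDiff_torusExp_neg_smul (u : EuclideanSpace ℝ (Fin r)) :
    ContMDiff 𝓘(ℝ, ℝ) (torusModel r) ∞ fun ε : ℝ => torusExp (-(ε • u)) :=
  contMDiff_torusExp.comp (ContDiff.contMDiff (by fun_prop))

/-- Allows continuity on the torus to be tested on `ℝ^r`. -/
lemma isOpenQuotientMap_torusExp :
    IsOpenQuotientMap (torusExp : EuclideanSpace ℝ (Fin r) → Torus r) :=
  (IsOpenQuotientMap.piMap fun _ : Fin r =>
    ⟨Circle.exp_surjective, Circle.exp.continuous, isLocalHomeomorph_circleExp.isOpenMap⟩).comp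
    (EuclideanSpace.equiv (Fin r) ℝ).toHomeomorph.isOpenQuotientMap

lemma torusChar_torusExp (a : Fin r → ℤ) (u : EuclideanSpace ℝ (Fin r)) :
    torusChar a (torusExp u) = Circle.exp (inner ℝ u (latticeVec a)) := by
  have h : (inner ℝ u (latticeVec a) : ℝ) = ∑ k, a k * u k := by
    simp [latticeVec, PiLp.inner_apply]
  rw [h]
  simp only [torusChar, torusExp]
  have hsum : ∀ s : Finset (Fin r), Circle.exp (∑ k ∈ s, a k * u k) =
      ∏ k ∈ s, Circle.exp (u k) ^ a k := by
    intro s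
    induction s using Finset.cons_induction with
    | empty => simp
    | cons k s hk ih => rw [Finset.sum_cons, Finset.prod_cons, Circle.exp_add, ih,
        Circle.exp_intCast_mul]
  exact (hsum _).symm

end TorusExp

/-! ### Maxima of the moment map and fixed points. -/

section Flow

/-- The model has no boundary, so the derivative within its range is a full derivative. -/
lemma HasMFDerivAt.hasFDerivAt_writtenInExtChartAt {m : ℕ} {M : Type*} [TopologicalSpace M]
    [ChartedSpace (EuclideanSpace ℝ (Fin m)) M] {F H' M' : Type*} [NormedAddCommGroup F]
    [NormedSpace ℝ F] [TopologicalSpace H'] {I' : ModelWithCorners ℝ F H'} [TopologicalSpace M']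
    [ChartedSpace H' M'] {f : M → M'} {p : M} {L : EuclideanSpace ℝ (Fin m) →L[ℝ] F}
    (h : HasMFDerivAt (𝓡 m) I' f p L) :
    HasFDerivAt (writtenInExtChartAt (𝓡 m) I' p f) L (extChartAt (𝓡 m) p p) := by
  have h2 : HasFDerivWithinAt (writtenInExtChartAt (𝓡 m) I' p f) L (Set.range (𝓡 m))
    (extChartAt (𝓡 m) p p) := h.2
  rwa [ModelWithCorners.range_eq_univ, hasFDerivWithinAt_univ] at h2

lemma mfderiv_eq_zero_of_forall_le {m : ℕ} {M : Type*} [TopologicalSpace M]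
    [ChartedSpace (EuclideanSpace ℝ (Fin m)) M] {f : M → ℝ} {p : M} (hp : ∀ x, f x ≤ f p) :
    mfderiv (𝓡 m) 𝓘(ℝ, ℝ) f p = 0 := by
  have hmax : IsLocalMax (writtenInExtChartAt (𝓡 m) 𝓘(ℝ, ℝ) p f) (extChartAt (𝓡 m) p p) :=
    Filter.Eventually.of_forall fun y => by
      simp only [writtenInExtChartAt, extChartAt_model_space_eq_id, PartialEquiv.refl_coe,
        Function.comp, id, extChartAt_to_inv]
      exact hp _
  by_cases hf : MDifferentiableAt (𝓡 m) 𝓘(ℝ, ℝ) f p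
  · exact hmax.hasFDerivAt_eq_zero hf.hasMFDerivAt.hasFDerivAt_writtenInExtChartAt
  -- Here `mfderiv` is zero by its default value.
  · exact mfderiv_zero_of_not_mdifferentiableAt hf

variable {m r : ℕ} {M : Type*} [TopologicalSpace M] [ChartedSpace (EuclideanSpace ℝ (Fin m)) M]
  [MulAction (Torus r) M]

lemma contMDiff_smul_const_torus (hT : ContMDiffSMul (torusModel r) (𝓡 m) ∞ (Torus r) M)
    (t : Torus r) : ContMDiff (𝓡 m) (𝓡 m) ∞ fun y : M => t • y :=
  hT.contMDiff_smul.comp (contMDiff_const.prodMk contMDiff_id)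

lemma contMDiff_torusExp_smul (hT : ContMDiffSMul (torusModel r) (𝓡 m) ∞ (Torus r) M)
    (u : EuclideanSpace ℝ (Fin r)) (x : M) :
    ContMDiff 𝓘(ℝ, ℝ) (𝓡 m) ∞ fun ε : ℝ => torusExp (-(ε • u)) • x :=
  hT.contMDiff_smul.comp ((contMDiff_torusExp_neg_smul u).prodMk contMDiff_const)

/-- A zero of the fundamental field of `u` is fixed by the one-parameter subgroup of `u`. -/
theorem torusExp_smul_eq_of_fundamentalField_eq_zero [T2Space M] [IsManifold (𝓡 m) ∞ M]
    (hT : ContMDiffSMul (torusModel r) (𝓡 m) ∞ (Torus r) M) (u : EuclideanSpace ℝ (Fin r)) (x : M)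
    (hx : fundamentalField m u x = 0) (s : ℝ) : torusExp (s • u) • x = x := by
  let c : ℝ → M := fun ε => torusExp (-(ε • u)) • x
  have hc : ContMDiff 𝓘(ℝ, ℝ) (𝓡 m) ∞ c := contMDiff_torusExp_smul hT u x
  have h0 : HasMFDerivAt 𝓘(ℝ, ℝ) (𝓡 m) c 0 0 := by
    have h := (hc.mdifferentiable (by simp) 0).hasMFDerivAt
    have hz : mfderiv 𝓘(ℝ, ℝ) (𝓡 m) c 0 = 0 := by
      refine ContinuousLinearMap.ext_ring ?_
      exact hx
    rwa [hz] at h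
  have : IsManifold (𝓡 m) 1 M := IsManifold.of_le (n := ∞) (by simp)
  have hright : (1 : ℝ →L[ℝ] ℝ).smulRight (0 : EuclideanSpace ℝ (Fin m)) = 0 := by
    ext; simp
  have hcomp : ∀ L : EuclideanSpace ℝ (Fin m) →L[ℝ] EuclideanSpace ℝ (Fin m),
      L.comp ((0 : ℝ →L[ℝ] EuclideanSpace ℝ (Fin m)).comp (ContinuousLinearMap.id ℝ ℝ)) =
        (1 : ℝ →L[ℝ] ℝ).smulRight (0 : EuclideanSpace ℝ (Fin m)) := fun L => by
    rw [hright, ContinuousLinearMap.zero_comp, ContinuousLinearMap.comp_zero]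
  have hcurve : IsMIntegralCurve (I := 𝓡 m) c (fun y => (0 : TangentSpace (𝓡 m) y)) := by
    intro s₀
    -- By the group law the velocity at `s₀` is the image of the velocity at `0`, which vanishes.
    have hshift : c = (fun y : M => torusExp (-(s₀ • u)) • y) ∘ c ∘ fun ε => ε - s₀ := by
      funext ε
      simp only [c, Function.comp, smul_smul, ← torusExp_add]
      congr 2
      module
    have h1 : HasMFDerivAt 𝓘(ℝ, ℝ) 𝓘(ℝ, ℝ) (fun ε : ℝ => ε - s₀) s₀
        (ContinuousLinearMap.id ℝ ℝ) :=
      ((hasFDerivAt_id s₀).sub_const s₀).hasMFDerivAt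
    have h2 : HasMFDerivAt 𝓘(ℝ, ℝ) (𝓡 m) (c ∘ fun ε => ε - s₀) s₀
        ((0 : ℝ →L[ℝ] EuclideanSpace ℝ (Fin m)).comp (ContinuousLinearMap.id ℝ ℝ)) := by
      refine HasMFDerivAt.comp s₀ ?_ h1
      rw [sub_self]
      exact h0
    have h3 := ((contMDiff_smul_const_torus hT (torusExp (-(s₀ • u)))).mdifferentiable (by simp)
      ((c ∘ fun ε => ε - s₀) s₀)).hasMFDerivAt.comp s₀ h2
    rw [← hshift] at h3
    exact h3.congr_mfderiv (hcomp _)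
  have hconst : IsMIntegralCurve (I := 𝓡 m) (fun _ => x) (fun y => (0 : TangentSpace (𝓡 m) y)) := by
    intro s₀
    exact (hasMFDerivAt_const x s₀).congr_mfderiv hright.symm
  have hzero : ContMDiff (𝓡 m) (𝓡 m).tangent 1
      (fun y : M => (⟨y, 0⟩ : TangentBundle (𝓡 m) M)) :=
    Bundle.contMDiff_zeroSection ℝ (TangentSpace (𝓡 m) : M → Type _)
  -- The orbit and the constant curve are both integral curves of the zero field, so they agree.
  have heq := isMIntegralCurve_Ioo_eq_of_contMDiff_boundaryless (t₀ := 0) hzero hcurve hconst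
    (by simp [c, torusExp_zero])
  have := congrFun heq (-s)
  simpa [c] using this

/-- A component of the moment map attains its maximum at a fixed point of the torus. -/
theorem exists_fixedPoint_isMax [T2Space M] [CompactSpace M] [Nonempty M] [IsManifold (𝓡 m) ∞ M]
    (Ω : TwoForm m M) (hΩ : IsSymplecticForm Ω)
    (hT : ContMDiffSMul (torusModel r) (𝓡 m) ∞ (Torus r) M)
    (μ : M → EuclideanSpace ℝ (Fin r)) (hμ : IsMomentMap Ω μ) (u : EuclideanSpace ℝ (Fin r)) :
    ∃ p ∈ MulAction.fixedPoints (Torus r) M, ∀ x, inner ℝ (μ x) u ≤ inner ℝ (μ p) u := by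
  have : ContinuousSMul (Torus r) M :=
    ContMDiffSMul.continuousSMul (I := torusModel r) (I' := 𝓡 m) ∞
  have hμc : Continuous μ := hμ.smooth.continuous
  have hgen : ∀ w : EuclideanSpace ℝ (Fin r),
      (∀ a : Fin r → ℤ, a ≠ 0 → ∑ k, a k * w k ≠ 0) →
      ∃ p ∈ MulAction.fixedPoints (Torus r) M, ∀ x, inner ℝ (μ x) w ≤ inner ℝ (μ p) w := by
    intro w hw
    have hHc : Continuous fun x => (inner ℝ (μ x) w : ℝ) := hμc.inner continuous_const
    obtain ⟨p, -, hp⟩ := isCompact_univ.exists_isMaxOn Set.univ_nonempty hHc.continuousOn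
    refine ⟨p, ?_, fun x => hp (Set.mem_univ x)⟩
    have hcrit : mfderiv (𝓡 m) 𝓘(ℝ, ℝ) (fun y => (inner ℝ (μ y) w : ℝ)) p = 0 :=
      mfderiv_eq_zero_of_forall_le fun x => hp (Set.mem_univ x)
    have hX : fundamentalField m w p = 0 := hΩ.nondegenerate p _ fun v => by
      rw [← hμ.deriv_eq, hcrit]; rfl
    exact fun t => smul_eq_of_forall_torusExp_smul_eq w hw p
      (torusExp_smul_eq_of_fundamentalField_eq_zero hT w p hX) t
  -- Generic `w n` tend to `u`; their maximum points are fixed, and a cluster point of these is a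
  -- maximum for `u`.
  obtain ⟨w, hw, hwu⟩ := mem_closure_iff_seq_limit.mp (dense_setOf_rationally_independent r u)
  choose p hpfix hpmax using fun n => hgen (w n) (hw n)
  have hclosed : IsClosed (MulAction.fixedPoints (Torus r) M) := by
    have : MulAction.fixedPoints (Torus r) M = ⋂ t : Torus r, {x : M | t • x = x} := by
      ext x; simp [MulAction.mem_fixedPoints]
    rw [this]
    exact isClosed_iInter fun t => isClosed_eq (continuous_const_smul t) continuous_id
  obtain ⟨q, hq, hcl⟩ := hclosed.isCompact.exists_clusterPt
    (f := Filter.map p Filter.atTop) (by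
      rw [Filter.le_principal_iff]
      exact Filter.Eventually.of_forall (f := Filter.atTop) hpfix)
  refine ⟨q, hq, fun x => ?_⟩
  obtain ⟨U, hU, hUq⟩ := mapClusterPt_iff_ultrafilter.mp hcl
  have h1 : Filter.Tendsto (fun n => (inner ℝ (μ x) (w n) : ℝ)) U (nhds (inner ℝ (μ x) u)) :=
    (tendsto_const_nhds.inner hwu).mono_left hU
  have h2 : Filter.Tendsto (fun n => (inner ℝ (μ (p n)) (w n) : ℝ)) U (nhds (inner ℝ (μ q) u)) :=
    ((hμc.tendsto q).comp hUq).inner (hwu.mono_left hU)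
  exact le_of_tendsto_of_tendsto' h1 h2 fun n => hpmax n x

end Flow

/-! ### The isotropy representation. -/

section Isotropy

/-- Coordinates of a family of endomorphisms of a single tangent space. -/
lemma inTangentCoordinates_of_forall_eq {m : ℕ} {M : Type*} [TopologicalSpace M]
    [ChartedSpace (EuclideanSpace ℝ (Fin m)) M] [IsManifold (𝓡 m) 1 M] {N : Type*} {f g : N → M}
    (p : M) (hf : ∀ x, f x = p) (hg : ∀ x, g x = p)
    (ϕ : N → EuclideanSpace ℝ (Fin m) →L[ℝ] EuclideanSpace ℝ (Fin m)) (x₀ x : N) :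
    inTangentCoordinates (𝓡 m) (𝓡 m) f g ϕ x₀ x = ϕ x := by
  obtain rfl : f = fun _ => p := funext hf
  obtain rfl : g = fun _ => p := funext hg
  rw [inTangentCoordinates_eq _ _ _ (mem_chart_source _ p) (mem_chart_source _ p)]
  have hself : ∀ z, (tangentBundleCore (𝓡 m) M).coordChange (achart _ p) (achart _ p) p z = z :=
    fun z => (tangentBundleCore (𝓡 m) M).coordChange_self _ _ (mem_chart_source _ p) z
  ext1 v
  simp only [ContinuousLinearMap.comp_apply, hself]

variable {m r : ℕ} {M : Type*} [TopologicalSpace M] [ChartedSpace (EuclideanSpace ℝ (Fin m)) M]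
  [MulAction (Torus r) M]

lemma isotropyRep_one (p : MulAction.fixedPoints (Torus r) M)
    (v : TangentSpace (𝓡 m) (p : M)) : isotropyRep m p 1 v = v := by
  have h : (fun y : M => (1 : Torus r) • y) = id := funext fun y => one_smul _ y
  change mfderiv (𝓡 m) (𝓡 m) (fun y : M => (1 : Torus r) • y) (p : M) v = v
  have h2 : HasMFDerivAt (𝓡 m) (𝓡 m) (fun y : M => (1 : Torus r) • y) (p : M)
      (ContinuousLinearMap.id ℝ (EuclideanSpace ℝ (Fin m))) := by
    rw [h]
    exact hasMFDerivAt_id (p : M)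
  exact congrArg (fun L : EuclideanSpace ℝ (Fin m) →L[ℝ] EuclideanSpace ℝ (Fin m) => L v)
    h2.mfderiv

lemma isotropyRep_mul (hT : ContMDiffSMul (torusModel r) (𝓡 m) ∞ (Torus r) M)
    (p : MulAction.fixedPoints (Torus r) M) (s t : Torus r)
    (v : TangentSpace (𝓡 m) (p : M)) :
    isotropyRep m p (s * t) v = isotropyRep m p s (isotropyRep m p t v) := by
  have h : (fun y : M => (s * t) • y) = (fun y : M => s • y) ∘ fun y : M => t • y :=
    funext fun y => mul_smul _ _ y
  change mfderiv (𝓡 m) (𝓡 m) (fun y : M => (s * t) • y) (p : M) v = _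
  rw [h]
  exact mfderiv_comp_apply_of_eq (p : M)
    ((contMDiff_smul_const_torus hT s).mdifferentiable (by simp) (p : M))
    ((contMDiff_smul_const_torus hT t).mdifferentiable (by simp) (p : M)) (p.2 t) v

/-- The derivative of a smooth family is continuous in tangent coordinates, and at a fixed point the
change of coordinates is the identity. -/
lemma continuous_isotropyRep [IsManifold (𝓡 m) ∞ M]
    (hT : ContMDiffSMul (torusModel r) (𝓡 m) ∞ (Torus r) M)
    (p : MulAction.fixedPoints (Torus r) M) :
    Continuous (fun t => isotropyRep m p t :
      Torus r → EuclideanSpace ℝ (Fin m) →L[ℝ] EuclideanSpace ℝ (Fin m)) := by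
  have : IsManifold (𝓡 m) 1 M := IsManifold.of_le (n := ∞) (by simp)
  rw [isOpenQuotientMap_torusExp.isQuotientMap.continuous_iff, continuous_iff_continuousAt]
  intro w₀
  have hsmul : ContMDiff (𝓘(ℝ, EuclideanSpace ℝ (Fin r)).prod (𝓡 m)) (𝓡 m) ∞
      (Function.uncurry fun (w : EuclideanSpace ℝ (Fin r)) (y : M) => torusExp w • y) :=
    hT.contMDiff_smul.comp ((contMDiff_torusExp.comp contMDiff_fst).prodMk contMDiff_snd)
  have hc := (ContMDiffAt.mfderiv (m := 0) (x₀ := w₀) _ (fun _ => (p : M))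
    (hsmul _) contMDiffAt_const (by simp)).continuousAt
  refine hc.congr (Filter.Eventually.of_forall fun w => ?_)
  exact inTangentCoordinates_of_forall_eq (p : M) (fun _ => rfl) (fun w => p.2 (torusExp w)) _ w₀ w

/-- In a chart around a fixed point the isotropy representation is the derivative. -/
lemma hasFDerivAt_chart_isotropyRep (hT : ContMDiffSMul (torusModel r) (𝓡 m) ∞ (Torus r) M)
    (p : MulAction.fixedPoints (Torus r) M) (t : Torus r) :
    HasFDerivAt (fun y => extChartAt (𝓡 m) (p : M) (t • (extChartAt (𝓡 m) (p : M)).symm y))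
      (isotropyRep m p t : EuclideanSpace ℝ (Fin m) →L[ℝ] EuclideanSpace ℝ (Fin m))
      (extChartAt (𝓡 m) (p : M) p) := by
  have h := ((contMDiff_smul_const_torus hT t).mdifferentiable
    (by simp) (p : M)).hasMFDerivAt.hasFDerivAt_writtenInExtChartAt
  have hp : t • (p : M) = p := p.2 t
  unfold writtenInExtChartAt at h
  simp only [hp] at h
  exact h

end Isotropy

/-! ### Alternating forms and second derivatives. -/

section Calculus

section Alternating

variable {E : Type*} [AddCommGroup E] [Module ℝ E] [TopologicalSpace E] (B : E [⋀^Fin 2]→L[ℝ] ℝ)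

lemma ContinuousAlternatingMap.map_smul_left (c : ℝ) (x y : E) :
    B ![c • x, y] = c • B ![x, y] := by
  have h := B.map_update_smul ![x, y] 0 c x
  have e : ∀ z, Function.update ![x, y] 0 z = ![z, y] := fun z => by
    ext i; fin_cases i <;> simp
  rwa [e, e] at h

lemma ContinuousAlternatingMap.map_add_left (x x' y : E) :
    B ![x + x', y] = B ![x, y] + B ![x', y] := by
  have h := B.map_update_add ![x, y] 0 x x'
  have e : ∀ z, Function.update ![x, y] 0 z = ![z, y] := fun z => by
    ext i; fin_cases i <;> simp
  rwa [e, e, e] at h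

lemma ContinuousAlternatingMap.map_vec_swap (x y : E) : B ![x, y] = -B ![y, x] := by
  have h := B.toAlternatingMap.map_swap ![y, x] (i := 0) (j := 1) (by simp)
  have e : ![y, x] ∘ Equiv.swap (0 : Fin 2) 1 = ![x, y] := by
    ext i; fin_cases i <;> simp
  rw [e] at h
  exact h

/-- The bilinear form of an alternating form of degree two. -/
noncomputable def ContinuousAlternatingMap.toBilin : E →ₗ[ℝ] E →ₗ[ℝ] ℝ :=
  LinearMap.mk₂ ℝ (fun x y => B ![x, y]) (B.map_add_left) (B.map_smul_left)
    (fun x y y' => by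
      rw [B.map_vec_swap, B.map_add_left, neg_add, ← B.map_vec_swap, ← B.map_vec_swap])
    (fun c x y => by
      rw [B.map_vec_swap, B.map_smul_left, ← smul_neg, ← B.map_vec_swap])

end Alternating

/-- Equality of mixed partial derivatives. -/
lemma hasDerivAt_fderiv_swap {E : Type*} [NormedAddCommGroup E] [NormedSpace ℝ E]
    {F : ℝ × ℝ → E} (hF : ContDiffAt ℝ 2 F (0, 0)) {L : E}
    (h : HasDerivAt (fun ε : ℝ => fderiv ℝ F (ε, 0) (0, 1)) L 0) :
    HasDerivAt (fun s : ℝ => fderiv ℝ F (0, s) (1, 0)) L 0 := by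
  have hd : HasFDerivAt (fderiv ℝ F) (fderiv ℝ (fderiv ℝ F) (0, 0)) (0, 0) :=
    ((hF.fderiv_right (m := 1) (by norm_num)).differentiableAt (by simp)).hasFDerivAt
  have hsymm : IsSymmSndFDerivAt ℝ F (0, 0) := hF.isSymmSndFDerivAt (by simp)
  have h1 : HasDerivAt (fun ε : ℝ => ((ε, 0) : ℝ × ℝ)) (1, 0) 0 :=
    (hasDerivAt_id 0).prodMk (hasDerivAt_const 0 0)
  have h2 : HasDerivAt (fun s : ℝ => ((0, s) : ℝ × ℝ)) (0, 1) 0 :=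
    (hasDerivAt_const 0 0).prodMk (hasDerivAt_id 0)
  have h3 := (hd.comp_hasDerivAt_of_eq (0 : ℝ) h1 rfl).clm_apply (hasDerivAt_const (0 : ℝ) ((0, 1) : ℝ × ℝ))
  have h4 := (hd.comp_hasDerivAt_of_eq (0 : ℝ) h2 rfl).clm_apply (hasDerivAt_const (0 : ℝ) ((1, 0) : ℝ × ℝ))
  have hL : L = fderiv ℝ (fderiv ℝ F) (0, 0) (1, 0) (0, 1) := by
    simpa using h.unique h3
  rw [hL, hsymm.eq]
  simpa using h4

/-- The derivative of `s ↦ W s (ξ s, v)` at a zero of `ξ`. -/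
lemma hasDerivAt_alternating_of_eq_zero {E : Type*} [NormedAddCommGroup E] [NormedSpace ℝ E]
    {W : ℝ → E [⋀^Fin 2]→L[ℝ] ℝ} {ξ : ℝ → E} {ξ' v : E} (hW : ContinuousAt W 0)
    (hξ : HasDerivAt ξ ξ' 0) (hξ0 : ξ 0 = 0) :
    HasDerivAt (fun s => W s ![ξ s, v]) (W 0 ![ξ', v]) 0 := by
  -- Since `ξ 0 = 0`, the quotient is `W s (s⁻¹ ξ s, v)`, so continuity of `W` suffices.
  rw [hasDerivAt_iff_tendsto_slope_zero] at hξ ⊢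
  have h0 : W 0 ![ξ 0, v] = 0 := by
    rw [hξ0]
    exact (W 0).map_coord_zero (m := ![0, v]) 0 rfl
  rw [h0]
  simp only [zero_add, sub_zero, hξ0] at hξ ⊢
  simp only [← ContinuousAlternatingMap.map_smul_left]
  have hv : Filter.Tendsto (fun s : ℝ => ![s⁻¹ • ξ s, v]) (nhdsWithin 0 {0}ᶜ) (nhds ![ξ', v]) := by
    rw [tendsto_pi_nhds]
    intro i
    fin_cases i
    · exact hξ
    · exact tendsto_const_nhds
  have hW' : Filter.Tendsto (fun s => (W s).toContinuousMultilinearMap) (nhdsWithin 0 {0}ᶜ)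
      (nhds (W 0).toContinuousMultilinearMap) :=
    (ContinuousAlternatingMap.continuous_toContinuousMultilinearMap.tendsto _).comp
      (hW.tendsto.mono_left nhdsWithin_le_nhds)
  exact hW'.eval hv

/-- A function cannot have a maximum where its second derivative is positive. -/
lemma nonpos_of_hasDerivAt_of_forall_le {h h' : ℝ → ℝ} {c : ℝ} (hmax : ∀ s, h s ≤ h 0)
    (hd : ∀ᶠ s in nhds 0, HasDerivAt h (h' s) s) (h0 : HasDerivAt h' c 0) : c ≤ 0 := by
  by_contra! hc
  have heq : deriv h =ᶠ[nhds 0] h' := hd.mono fun s hs => hs.deriv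
  have hdd : deriv (deriv h) 0 = c := by rw [heq.deriv_eq, h0.deriv]
  have hlm : IsLocalMax h 0 := Filter.Eventually.of_forall hmax
  -- A point that is both a local minimum and a maximum makes `h` locally constant, contradicting `c
  -- > 0`.
  have hmin : IsLocalMin h 0 := isLocalMin_of_deriv_deriv_pos (by rw [hdd]; exact hc)
    hlm.deriv_eq_zero hd.self_of_nhds.continuousAt
  have hconst : h =ᶠ[nhds 0] fun _ => h 0 := hmin.mono fun s hs => le_antisymm (hmax s) hs
  have : deriv (deriv h) 0 = 0 := by
    rw [hconst.deriv.deriv_eq]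
    simp
  linarith

end Calculus

/-! ### The Hessian of the Hamiltonian at a fixed point. -/

section Hessian

variable {m : ℕ} {M : Type*} [TopologicalSpace M] [ChartedSpace (EuclideanSpace ℝ (Fin m)) M]

lemma mdifferentiableAt_extChartAt_symm_of_mem_target [IsManifold (𝓡 m) ∞ M] (p : M)
    {y : EuclideanSpace ℝ (Fin m)} (hy : y ∈ (extChartAt (𝓡 m) p).target) :
    MDifferentiableAt 𝓘(ℝ, EuclideanSpace ℝ (Fin m)) (𝓡 m) (extChartAt (𝓡 m) p).symm y :=
  ((contMDiffOn_extChartAt_symm (n := ∞) p).contMDiffAt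
    ((isOpen_extChartAt_target p).mem_nhds hy)).mdifferentiableAt (by simp)

/-- At the centre of the chart, the inverse of the chart has the identity as differential. -/
lemma mfderiv_extChartAt_symm_self [IsManifold (𝓡 m) ∞ M] (p : M) :
    mfderiv 𝓘(ℝ, EuclideanSpace ℝ (Fin m)) (𝓡 m) (extChartAt (𝓡 m) p).symm
      (extChartAt (𝓡 m) p p) = ContinuousLinearMap.id ℝ (EuclideanSpace ℝ (Fin m)) := by
  have hmem := mem_extChartAt_target (I := 𝓡 m) p
  have h := (mdifferentiableAt_extChartAt_symm_of_mem_target p hmem).hasMFDerivAt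
    |>.hasFDerivAt_writtenInExtChartAt
  simp only [writtenInExtChartAt, extChartAt_model_space_eq_id, PartialEquiv.refl_coe,
    PartialEquiv.refl_symm, id, extChartAt_to_inv, Function.comp_def] at h
  refine h.unique ((hasFDerivAt_id _).congr_of_eventuallyEq ?_)
  filter_upwards [(isOpen_extChartAt_target p).mem_nhds hmem] with y hy
  exact (extChartAt (𝓡 m) p).right_inv hy

lemma TwoForm.inChart_self [IsManifold (𝓡 m) ∞ M] (Ω : TwoForm m M) (p : M) :
    Ω.inChart p (extChartAt (𝓡 m) p p) = Ω p := by
  -- The base points agree only propositionally; generalizing over them permits substitution.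
  have key : ∀ (x : M) (D : EuclideanSpace ℝ (Fin m) →L[ℝ] EuclideanSpace ℝ (Fin m)), x = p →
      D = ContinuousLinearMap.id ℝ (EuclideanSpace ℝ (Fin m)) →
      (show EuclideanSpace ℝ (Fin m) [⋀^Fin 2]→L[ℝ] ℝ from Ω x).compContinuousLinearMap D =
        Ω p := by
    rintro x D rfl rfl
    rfl
  exact key _ _ (extChartAt_to_inv p) (mfderiv_extChartAt_symm_self p)

variable {r : ℕ} [MulAction (Torus r) M]

/-- The action of a one-parameter subgroup on a line, in the chart at `p`. -/
noncomputable def chartFlow (p : M) (u : EuclideanSpace ℝ (Fin r)) (v : EuclideanSpace ℝ (Fin m))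
    (q : ℝ × ℝ) : EuclideanSpace ℝ (Fin m) :=
  extChartAt (𝓡 m) p
    (torusExp (-(q.1 • u)) • (extChartAt (𝓡 m) p).symm (extChartAt (𝓡 m) p p + q.2 • v))

lemma contDiffAt_chartFlow [IsManifold (𝓡 m) ∞ M]
    (hT : ContMDiffSMul (torusModel r) (𝓡 m) ∞ (Torus r) M) (p : M)
    (u : EuclideanSpace ℝ (Fin r)) (v : EuclideanSpace ℝ (Fin m)) {s : ℝ}
    (hs : extChartAt (𝓡 m) p p + s • v ∈ (extChartAt (𝓡 m) p).target) :
    ContDiffAt ℝ ∞ (chartFlow p u v) (0, s) := by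
  rw [← contMDiffAt_iff_contDiffAt]
  have h1 : ContMDiffAt 𝓘(ℝ, ℝ × ℝ) (torusModel r) ∞
      (fun q : ℝ × ℝ => torusExp (-(q.1 • u))) (0, s) :=
    (contMDiff_torusExp.comp (ContDiff.contMDiff (by fun_prop))) _
  have h2 : ContMDiffAt 𝓘(ℝ, ℝ × ℝ) (𝓡 m) ∞ (fun q : ℝ × ℝ =>
      (extChartAt (𝓡 m) p).symm (extChartAt (𝓡 m) p p + q.2 • v)) (0, s) :=
    ContMDiffAt.comp (0, s) (g := (extChartAt (𝓡 m) p).symm)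
      (f := fun q : ℝ × ℝ => extChartAt (𝓡 m) p p + q.2 • v)
      ((contMDiffOn_extChartAt_symm (n := ∞) p).contMDiffAt
        ((isOpen_extChartAt_target p).mem_nhds hs))
      (ContDiff.contMDiff (by fun_prop) _)
  have h3 := ContMDiffAt.comp (0, s) (hT.contMDiff_smul _) (h1.prodMk h2)
  refine ContMDiffAt.comp (0, s) (g := extChartAt (𝓡 m) p) (contMDiffAt_extChartAt' ?_) h3
  simp only [zero_smul, neg_zero, torusExp_zero, one_smul]
  rw [← extChartAt_source (𝓡 m)]
  exact (extChartAt (𝓡 m) p).map_target hs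

/-- The derivative of the Hamiltonian along a line in the chart at `p`. -/
lemma hasDerivAt_momentMap_chart [IsManifold (𝓡 m) ∞ M]
    (Ω : TwoForm m M) (hT : ContMDiffSMul (torusModel r) (𝓡 m) ∞ (Torus r) M)
    (μ : M → EuclideanSpace ℝ (Fin r)) (hμ : IsMomentMap Ω μ) (p : M)
    (u : EuclideanSpace ℝ (Fin r)) (v : EuclideanSpace ℝ (Fin m)) {s : ℝ}
    (hs : extChartAt (𝓡 m) p p + s • v ∈ (extChartAt (𝓡 m) p).target) :
    HasDerivAt (fun s : ℝ => (inner ℝ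
        (μ ((extChartAt (𝓡 m) p).symm (extChartAt (𝓡 m) p p + s • v))) u : ℝ))
      (Ω.inChart p (extChartAt (𝓡 m) p p + s • v)
        ![fderiv ℝ (chartFlow p u v) (0, s) (1, 0), v]) s := by
  set φ := extChartAt (𝓡 m) p with hφ
  set y := φ p + s • v with hy
  set x := φ.symm y with hx
  let D : EuclideanSpace ℝ (Fin m) →L[ℝ] EuclideanSpace ℝ (Fin m) :=
    mfderiv 𝓘(ℝ, EuclideanSpace ℝ (Fin m)) (𝓡 m) φ.symm y
  have hD : HasMFDerivAt 𝓘(ℝ, EuclideanSpace ℝ (Fin m)) (𝓡 m) φ.symm y D :=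
    (mdifferentiableAt_extChartAt_symm_of_mem_target p hs).hasMFDerivAt
  have hFs : HasDerivAt (fun ε : ℝ => chartFlow p u v (ε, s))
      (fderiv ℝ (chartFlow p u v) (0, s) (1, 0)) 0 := by
    have h1 : HasDerivAt (fun ε : ℝ => ((ε, s) : ℝ × ℝ)) (1, 0) 0 :=
      (hasDerivAt_id 0).prodMk (hasDerivAt_const 0 s)
    exact ((contDiffAt_chartFlow hT p u v hs).differentiableAt
      (by simp)).hasFDerivAt.comp_hasDerivAt_of_eq (0 : ℝ) h1 rfl
  have hF0 : chartFlow p u v (0, s) = y := by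
    simp only [chartFlow, zero_smul, neg_zero, torusExp_zero, one_smul]
    exact φ.right_inv hs
  -- In the chart the field is the time derivative of the flow.
  have hX : fundamentalField m u x = D (fderiv ℝ (chartFlow p u v) (0, s) (1, 0)) := by
    have hcurve := contMDiff_torusExp_smul hT u x
    have hcomp : HasMFDerivAt 𝓘(ℝ, ℝ) (𝓡 m) (φ.symm ∘ fun ε : ℝ => chartFlow p u v (ε, s)) 0
        (D.comp (ContinuousLinearMap.toSpanSingleton ℝ
          (fderiv ℝ (chartFlow p u v) (0, s) (1, 0)))) := by
      refine HasMFDerivAt.comp (0 : ℝ) ?_ hFs.hasFDerivAt.hasMFDerivAt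
      rw [hF0]
      exact hD
    -- Only for small `ε` does the orbit stay in the chart domain.
    have hev : (fun ε : ℝ => torusExp (-(ε • u)) • x) =ᶠ[nhds 0]
        φ.symm ∘ fun ε : ℝ => chartFlow p u v (ε, s) := by
      have hsrc : ∀ᶠ ε : ℝ in nhds 0, torusExp (-(ε • u)) • x ∈ φ.source := by
        refine hcurve.continuous.continuousAt.eventually_mem
          ((isOpen_extChartAt_source p).mem_nhds ?_)
        simp only [zero_smul, neg_zero, torusExp_zero, one_smul]
        exact φ.map_target hs
      filter_upwards [hsrc] with ε hε
      exact (φ.left_inv hε).symm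
    have h2 := (hcomp.congr_of_eventuallyEq hev).mfderiv
    have h3 : fundamentalField m u x = (D.comp (ContinuousLinearMap.toSpanSingleton ℝ
          (fderiv ℝ (chartFlow p u v) (0, s) (1, 0)))) (1 : ℝ) :=
      congrArg (fun L : ℝ →L[ℝ] EuclideanSpace ℝ (Fin m) => L 1) h2
    rw [h3]
    exact congrArg D (one_smul ℝ _)
  have hH : MDifferentiableAt (𝓡 m) 𝓘(ℝ, ℝ) (fun z => (inner ℝ (μ z) u : ℝ)) x := by
    have hin : ContMDiff 𝓘(ℝ, EuclideanSpace ℝ (Fin r)) 𝓘(ℝ, ℝ) ∞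
        (fun z : EuclideanSpace ℝ (Fin r) => (inner ℝ z u : ℝ)) :=
      ContDiff.contMDiff (contDiff_id.inner ℝ contDiff_const)
    exact (hin.comp hμ.smooth).mdifferentiable (by simp) x
  let L : EuclideanSpace ℝ (Fin m) →L[ℝ] ℝ :=
    mfderiv (𝓡 m) 𝓘(ℝ, ℝ) (fun z => (inner ℝ (μ z) u : ℝ)) x
  have hchain : HasFDerivAt ((fun z => (inner ℝ (μ z) u : ℝ)) ∘ φ.symm) (L.comp D) y :=
    (HasMFDerivAt.comp y hH.hasMFDerivAt hD).hasFDerivAt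
  have hline : HasDerivAt (fun s : ℝ => φ p + s • v) v s := by
    simpa using ((hasDerivAt_id s).smul_const v).const_add (φ p)
  have hfin := hchain.comp_hasDerivAt_of_eq s hline rfl
  have hval : (L.comp D) v = Ω.inChart p y ![fderiv ℝ (chartFlow p u v) (0, s) (1, 0), v] := by
    have e1 : (L.comp D) v = Ω x ![fundamentalField m u x, D v] := hμ.deriv_eq u x (D v)
    rw [e1, hX]
    change _ = Ω x (D ∘ ![fderiv ℝ (chartFlow p u v) (0, s) (1, 0), v])
    congr 1
    ext i
    fin_cases i <;> rfl
  rw [← hval]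
  exact hfin

/-- The Hessian of a Hamiltonian at a fixed point in the direction of a weight vector: at a
maximum, the weight is nonpositive. -/
theorem inner_latticeVec_nonpos_of_isMax [IsManifold (𝓡 m) ∞ M]
    (Ω : TwoForm m M) (hΩ : IsSymplecticForm Ω)
    (hT : ContMDiffSMul (torusModel r) (𝓡 m) ∞ (Torus r) M)
    (μ : M → EuclideanSpace ℝ (Fin r)) (hμ : IsMomentMap Ω μ)
    (p : MulAction.fixedPoints (Torus r) M) (u : EuclideanSpace ℝ (Fin r))
    (hmax : ∀ x, inner ℝ (μ x) u ≤ inner ℝ (μ (p : M)) u) (a : Fin r → ℤ)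
    (v w : EuclideanSpace ℝ (Fin m))
    (hpos : 0 < Ω p ![v, w])
    (hv : ∀ t : Torus r, isotropyRep m p t v =
       (torusChar a t : ℂ).re • v + (torusChar a t : ℂ).im • w) :
    inner ℝ u (latticeVec a) ≤ 0 := by
  set c : ℝ := inner ℝ u (latticeVec a) with hc
  set φ := extChartAt (𝓡 m) (p : M) with hφ
  have hmem : φ p ∈ φ.target := mem_extChartAt_target (I := 𝓡 m) (p : M)
  have hline : Continuous fun s : ℝ => φ p + s • v := by fun_prop
  have htarget : ∀ᶠ s : ℝ in nhds 0, φ p + s • v ∈ φ.target :=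
    hline.continuousAt.eventually_mem
      ((isOpen_extChartAt_target (p : M)).mem_nhds (by rwa [zero_smul, add_zero]))
  have hF : ContDiffAt ℝ 2 (chartFlow (p : M) u v) (0, 0) :=
    (contDiffAt_chartFlow hT (p : M) u v (by rwa [zero_smul, add_zero])).of_le
      (WithTop.coe_le_coe.mpr le_top)
  have hFdiff : ∀ᶠ q in nhds ((0, 0) : ℝ × ℝ), DifferentiableAt ℝ (chartFlow (p : M) u v) q :=
    (hF.eventually (by simp)).mono fun q hq => hq.differentiableAt (by simp)
  -- The space derivative at `p` of the flow is the isotropy representation of `exp(-εu)`, a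
  -- rotation by `-εc` on `v` and `w`.
  have hpartial : (fun ε : ℝ => fderiv ℝ (chartFlow (p : M) u v) (ε, 0) (0, 1)) =ᶠ[nhds 0]
      fun ε => Real.cos (-(ε * c)) • v + Real.sin (-(ε * c)) • w := by
    have htend : Filter.Tendsto (fun ε : ℝ => ((ε, 0) : ℝ × ℝ)) (nhds 0) (nhds (0, 0)) :=
      (Continuous.prodMk continuous_id continuous_const).tendsto' _ _ rfl
    filter_upwards [htend.eventually hFdiff] with ε hε
    have h1 : HasDerivAt (fun s : ℝ => ((ε, s) : ℝ × ℝ)) (0, 1) 0 :=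
      (hasDerivAt_const 0 ε).prodMk (hasDerivAt_id 0)
    have h2 := hε.hasFDerivAt.comp_hasDerivAt_of_eq (0 : ℝ) h1 rfl
    have h3 : HasDerivAt (fun s : ℝ => φ p + s • v) v 0 := by
      simpa using ((hasDerivAt_id (0 : ℝ)).smul_const v).const_add (φ p)
    have h4 := (hasFDerivAt_chart_isotropyRep hT p
      (torusExp (-(ε • u)))).comp_hasDerivAt_of_eq (0 : ℝ) h3 (by simp [hφ])
    have h5 := h2.unique h4
    rw [h5]
    refine (hv _).trans ?_
    have h6 : (inner ℝ (-(ε • u)) (latticeVec a) : ℝ) = -(ε * c) := by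
      rw [inner_neg_left, real_inner_smul_left]
    rw [torusChar_torusExp, h6, Circle.coe_exp, Complex.exp_ofReal_mul_I_re,
      Complex.exp_ofReal_mul_I_im]
  have hcos : HasDerivAt (fun ε : ℝ => Real.cos (-(ε * c)) • v + Real.sin (-(ε * c)) • w)
      (-(c • w)) 0 := by
    have hlin : HasDerivAt (fun ε : ℝ => -(ε * c)) (-c) 0 := by
      have h := ((hasDerivAt_id (0 : ℝ)).mul_const c).neg
      rw [one_mul] at h
      exact h
    have h := (hlin.cos.smul_const v).add (hlin.sin.smul_const w)
    have e : (-Real.sin (-(0 * c)) * -c) • v + (Real.cos (-(0 * c)) * -c) • w = -(c • w) := by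
      simp
    rw [e] at h
    exact h
  -- Exchanging the partials: the field along the line has derivative `-c w` at `0`.
  have hξ := hasDerivAt_fderiv_swap hF (hcos.congr_of_eventuallyEq hpartial)
  have hξ0 : fderiv ℝ (chartFlow (p : M) u v) (0, 0) (1, 0) = 0 := by
    have h1 : HasDerivAt (fun ε : ℝ => ((ε, 0) : ℝ × ℝ)) (1, 0) 0 :=
      (hasDerivAt_id 0).prodMk (hasDerivAt_const 0 0)
    have h2 := hFdiff.self_of_nhds.hasFDerivAt.comp_hasDerivAt_of_eq (0 : ℝ) h1 rfl
    have h3 : (chartFlow (p : M) u v ∘ fun ε : ℝ => ((ε, 0) : ℝ × ℝ)) = fun _ => φ p := by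
      funext ε
      simp only [Function.comp, chartFlow, zero_smul, add_zero, extChartAt_to_inv]
      rw [show torusExp (-(ε • u)) • (p : M) = p from p.2 _]
    rw [h3] at h2
    exact h2.unique (hasDerivAt_const _ _)
  have hW : ContinuousAt (fun s : ℝ => Ω.inChart (p : M) (φ p + s • v)) 0 := by
    refine ContinuousAt.comp (g := Ω.inChart (p : M)) ?_ hline.continuousAt
    rw [zero_smul, add_zero]
    exact (hΩ.smooth p).continuousOn.continuousAt
      ((isOpen_extChartAt_target (p : M)).mem_nhds hmem)
  -- The second derivative of the Hamiltonian is `Ω(-c w, v) = c Ω(v, w)`.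
  have hsecond := hasDerivAt_alternating_of_eq_zero (v := v) hW hξ hξ0
  have hle := nonpos_of_hasDerivAt_of_forall_le
    (h := fun s : ℝ => (inner ℝ (μ (φ.symm (φ p + s • v))) u : ℝ))
    (fun s => by
      simp only [zero_smul, add_zero, hφ, extChartAt_to_inv]
      exact hmax _)
    (htarget.mono fun s hs => hasDerivAt_momentMap_chart Ω hT μ hμ (p : M) u v hs) hsecond
  simp only [zero_smul, add_zero] at hle
  rw [hφ, TwoForm.inChart_self] at hle
  have hval : ∀ B : EuclideanSpace ℝ (Fin m) [⋀^Fin 2]→L[ℝ] ℝ,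
      B ![-(c • w), v] = c * B ![v, w] := fun B => by
    rw [← neg_smul, B.map_smul_left, B.map_vec_swap, smul_eq_mul, neg_mul_neg]
  have hfin : c * Ω p ![v, w] ≤ 0 := (hval (Ω p)).symm.trans_le hle
  exact nonpos_of_mul_nonpos_left hfin hpos

end Hessian

/-- The weights at the fixed points of a Hamiltonian torus action do not lie in an open half-space:
at a fixed point where `⟨μ, u⟩` is maximal, every weight `a` has `⟨u, a⟩ ≤ 0`. Fixed points need not
be isolated for this argument. -/
theorem mainTheorem8 {n r : ℕ} (hn : 0 < n) {M : Type*} [TopologicalSpace M] [T2Space M]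
    [CompactSpace M] [Nonempty M] [ChartedSpace (EuclideanSpace ℝ (Fin (2 * n))) M]
    [IsManifold (𝓡 (2 * n)) ∞ M] [MulAction (Torus r) M]
    (Ω : TwoForm (2 * n) M) (hΩ : IsSymplecticForm Ω) (hT : IsHamiltonianAction r Ω)
    (hfix : DiscreteTopology (MulAction.fixedPoints (Torus r) M)) :
    ¬ ∃ u : EuclideanSpace ℝ (Fin r), u ≠ 0 ∧
      ∀ p : MulAction.fixedPoints (Torus r) M, ∀ a ∈ isotropyWeights Ω p,
        latticeVec a ∈ openHalfSpace u := by
  rintro ⟨u, -, hu⟩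
  obtain ⟨μ, hμ⟩ := hT.exists_momentMap
  obtain ⟨p, hp, hmax⟩ := exists_fixedPoint_isMax Ω hΩ hT.smooth μ hμ u
  let p' : MulAction.fixedPoints (Torus r) M := ⟨p, hp⟩
  let B : EuclideanSpace ℝ (Fin (2 * n)) [⋀^Fin 2]→L[ℝ] ℝ := Ω p
  -- A positive dimension makes the tangent space nontrivial, so that a weight exists.
  have : Nonempty (Fin (2 * n)) := ⟨⟨0, by omega⟩⟩
  have hΩp : ∀ x : M, x = p → ∀ v w : EuclideanSpace ℝ (Fin (2 * n)),
      Ω x ![v, w] = B ![v, w] := by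
    rintro x rfl v w
    rfl
  obtain ⟨I, hII, hIσ, hIpos, hIt, a, v, hv, hva⟩ := exists_weight_of_symplectic_representation
    (V := EuclideanSpace ℝ (Fin (2 * n))) (fun t => isotropyRep (2 * n) p' t)
    (isotropyRep_one p') (isotropyRep_mul hT.smooth p')
    (fun v => (continuous_isotropyRep hT.smooth p').clm_apply continuous_const)
    B.toBilin B.map_vec_swap (hΩ.nondegenerate p)
    (fun t v w => (hΩp (t • p) (hp t) _ _).symm.trans (hT.preserves t p v w))
  have hle := inner_latticeVec_nonpos_of_isMax Ω hΩ hT.smooth μ hμ p' u hmax a v (I v)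
    (hIpos v hv) hva
  exact absurd (hu p' a ⟨I, ⟨hII, hIσ, hIpos, hIt⟩, v, hv, hva⟩) (not_lt.mpr hle)
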